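/- Let $d\in\mathbb N$, let $\mathcal X\subseteq\mathbb R^d$ be a compact convex set with nonempty interior and $0\notin\mathcal X$, and let $c:\mathcal X\to\mathbb R$ be strongly convex and lower semicontinuous. Let $(\Delta,\mathbb P)$ be a probability space, and let $\delta\mapsto a_\delta$ and $\delta\mapsto b_\delta$ be measurable maps $\Delta\to\mathbb R^d$ such that $b_\delta^\top x>0$ for all $x\in\mathcal X$ and $\delta\in\Delta$. For a finite set $\omega\subseteq\Delta$, consider the sampled quasi-linear optimization problem $$\mathcal P(\omega):\quad \min_{x\in\mathbb R^d,\ \lambda\ge 0}\ (\lambda,c(x))\quad\text{s.t.}\quad x\in\mathcal X\ \text{ and }\ a_\delta^\top x\le\lambda\, b_\delta^\top x\quad\text{for all }\delta\in\omega,$$ where $(\lambda,c(x))$ is minimized in the lexicographic order (first component first), and let $\mathrm{Cost}(\omega)$ be its optimal cost, i.e. the value of $(\lambda,c(x))$ at its unique optimal solution. An essential set for $\mathcal P(\omega)$ is a set $\beta\subseteq\omega$ of minimal cardinality satisfying $\mathrm{Cost}(\beta)=\mathrm{Cost}(\omega)$. For $\bar\omega_N=(\delta_1,\dots,\delta_N)\in\Delta^N$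 write $\omega_N=\{\delta_1,\dots,\delta_N\}$. The vector $\bar\omega_N$ is called non-degenerate if there is a unique set $I\subseteq\{1,\dots,N\}$ such that $\{\delta_i\}_{i\in I}$ is an essential set for $\mathcal P(\omega_N)$, and its violating probability is $$V(\bar\omega_N)=\mathbb P\big(\{\delta\in\Delta:\mathrm{Cost}(\omega_N\cup\{\delta\})>\mathrm{Cost}(\omega_N)\}\big).$$ Assume that for every integer $N\ge1$ the vector $\bar\omega_N$ is non-degenerate for $\mathbb P^N$-almost every $\bar\omega_N\in\Delta^N$. Let $\zeta\ge1$ be an integer that is an upper bound on the cardinality of every essential set of $\mathcal P(\omega)$, for all finite $\omega\subseteq\Delta$. Then, for every integer $N\ge\zeta$ and every $\varepsilon\in(0,1)$, $$\mathbb P^N\big(\{\bar\omega_N\in\Delta^N:V(\bar\omega_N)>\varepsilon\}\big)\le\Phi(\varepsilon,\zeta-1,N),$$ where, for integers $0\le k<N$, $$\Phi(\varepsilon,k,N)=I_{1-\varepsilon}(N-k,k+1)=\frac{1}{B(N-k,k+1)}\int_0^{1-\varepsilon}t^{N-k-1}(1-t)^{k}\,dt=\sum_{j=0}^{k}\binom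 Nj\varepsilon^j(1-\varepsilon)^{N-j}$$ is the regularized incomplete beta function, $B$ being Euler's beta function. -/

import Mathlib

open MeasureTheory Set

noncomputable section

/-- The data of a quasi-linear optimization problem in `ℝ^d` with constraints indexed by `Δ`:
a compact convex set `X` with nonempty interior and `0 ∉ X`, vectors `a δ`, `b δ` with
`⟨b δ, x⟩ > 0` on `X`, and a strongly convex, lower semicontinuous secondary cost `c` on `X`
(the values of `c` outside `X` are never used). -/
structure QuasiLinearProblem (d : ℕ) (Δ : Type*) where
  X : Set (EuclideanSpace ℝ (Fin d))
  isCompact_X : IsCompact X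
  convex_X : Convex ℝ X
  interior_X : (interior X).Nonempty
  zero_notMem : (0 : EuclideanSpace ℝ (Fin d)) ∉ X
  a : Δ → EuclideanSpace ℝ (Fin d)
  b : Δ → EuclideanSpace ℝ (Fin d)
  b_pos : ∀ δ, ∀ x ∈ X, 0 < inner ℝ (b δ) x
  c : EuclideanSpace ℝ (Fin d) → ℝ
  strongConvex_c : ∃ m : ℝ, 0 < m ∧ StrongConvexOn X m c
  lsc_c : LowerSemicontinuousOn c X

namespace QuasiLinearProblem

variable {d : ℕ} {Δ : Type*} (P : QuasiLinearProblem d Δ)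

/-- `p = (lam, x)` is feasible for the sampled problem with constraint set `ω`. -/
def IsFeasible (ω : Finset Δ) (p : ℝ × EuclideanSpace ℝ (Fin d)) : Prop :=
  0 ≤ p.1 ∧ p.2 ∈ P.X ∧ ∀ δ ∈ ω, inner ℝ (P.a δ) p.2 ≤ p.1 * inner ℝ (P.b δ) p.2

/-- The objective value `(lam, c x)`, in the lexicographically ordered plane. -/
def objective (p : ℝ × EuclideanSpace ℝ (Fin d)) : ℝ ×ₗ ℝ := toLex (p.1, P.c p.2)

/-- `p` is an optimal solution: feasible, with lexicographically minimal objective. -/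
def IsOptimal (ω : Finset Δ) (p : ℝ × EuclideanSpace ℝ (Fin d)) : Prop :=
  P.IsFeasible ω p ∧ ∀ q, P.IsFeasible ω q → P.objective p ≤ P.objective q

theorem exists_isFeasible (ω : Finset Δ) : ∃ p, P.IsFeasible ω p := by
  obtain ⟨x, hx⟩ := P.interior_X
  have hxX := interior_subset hx
  refine ⟨(∑ δ ∈ ω, |inner ℝ (P.a δ) x| / inner ℝ (P.b δ) x, x), ?_, hxX, ?_⟩
  · exact Finset.sum_nonneg fun δ _ => div_nonneg (abs_nonneg _) (P.b_pos δ x hxX).le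
  · intro δ hδ
    have hb := P.b_pos δ x hxX
    have h : |inner ℝ (P.a δ) x| / inner ℝ (P.b δ) x
        ≤ ∑ δ ∈ ω, |inner ℝ (P.a δ) x| / inner ℝ (P.b δ) x :=
      Finset.single_le_sum (f := fun δ => |inner ℝ (P.a δ) x| / inner ℝ (P.b δ) x)
        (fun δ _ => div_nonneg (abs_nonneg _) (P.b_pos δ x hxX).le) hδ
    rw [div_le_iff₀ hb] at h
    exact (le_abs_self _).trans h

theorem exists_isOptimal (ω : Finset Δ) : ∃ p, P.IsOptimal ω p := by
  obtain ⟨p₀, h₀⟩ := P.exists_isFeasible ω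
  have hclosed : IsClosed {p : ℝ × EuclideanSpace ℝ (Fin d) |
      ∀ δ ∈ ω, inner ℝ (P.a δ) p.2 ≤ p.1 * inner ℝ (P.b δ) p.2} := by
    simp only [Set.ofPred_forall]
    exact isClosed_biInter fun δ _ => isClosed_le (by fun_prop) (by fun_prop)
  have hK : IsCompact ((Icc 0 p₀.1 ×ˢ P.X) ∩ {p : ℝ × EuclideanSpace ℝ (Fin d) |
      ∀ δ ∈ ω, inner ℝ (P.a δ) p.2 ≤ p.1 * inner ℝ (P.b δ) p.2}) :=
    (isCompact_Icc.prod P.isCompact_X).inter_right hclosed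
  obtain ⟨p₁, hp₁, hmin⟩ := hK.exists_isMinOn ⟨p₀, ⟨⟨h₀.1, le_rfl⟩, h₀.2.1⟩, h₀.2.2⟩
    (f := Prod.fst) continuous_fst.continuousOn
  have hlam : ∀ q, P.IsFeasible ω q → p₁.1 ≤ q.1 := by
    intro q hq
    rcases le_total q.1 p₀.1 with h | h
    · exact hmin ⟨⟨⟨hq.1, h⟩, hq.2.1⟩, hq.2.2⟩
    · exact hp₁.1.1.2.trans h
  have hS : IsClosed {x : EuclideanSpace ℝ (Fin d) |
      ∀ δ ∈ ω, inner ℝ (P.a δ) x ≤ p₁.1 * inner ℝ (P.b δ) x} := by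
    simp only [Set.ofPred_forall]
    exact isClosed_biInter fun δ _ => isClosed_le (by fun_prop) (by fun_prop)
  obtain ⟨x, hx, hxmin⟩ := LowerSemicontinuousOn.exists_isMinOn
    (s := P.X ∩ {x | ∀ δ ∈ ω, inner ℝ (P.a δ) x ≤ p₁.1 * inner ℝ (P.b δ) x})
    ⟨p₁.2, hp₁.1.2, hp₁.2⟩ (P.isCompact_X.inter_right hS) (P.lsc_c.mono inter_subset_left)
  refine ⟨(p₁.1, x), ⟨hp₁.1.1.1, hx.1, hx.2⟩, fun q hq => ?_⟩
  rw [objective, objective, Prod.Lex.toLex_le_toLex]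
  rcases (hlam q hq).lt_or_eq with h | h
  · exact Or.inl h
  · refine Or.inr ⟨h, hxmin ⟨hq.2.1, ?_⟩⟩
    have := hq.2.2
    rw [← h] at this
    exact this

theorem IsOptimal.unique {P : QuasiLinearProblem d Δ} {ω : Finset Δ}
    {p q : ℝ × EuclideanSpace ℝ (Fin d)} (hp : P.IsOptimal ω p) (hq : P.IsOptimal ω q) :
    p = q := by
  have h : P.objective p = P.objective q := le_antisymm (hp.2 q hq.1) (hq.2 p hp.1)
  have h' : (p.1, P.c p.2) = (q.1, P.c q.2) := toLex.injective h
  obtain ⟨h1, h2⟩ := Prod.mk.inj h'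
  obtain ⟨lam, x⟩ := p
  obtain ⟨lam', y⟩ := q
  dsimp only at h1 h2
  subst h1
  by_contra hne
  have hxy : x ≠ y := fun h => hne (by rw [h])
  obtain ⟨m, hm, hc⟩ := P.strongConvex_c
  have hlt : P.c ((1 / 2 : ℝ) • x + (1 / 2 : ℝ) • y)
      < (1 / 2 : ℝ) • P.c x + (1 / 2 : ℝ) • P.c y :=
    (hc.strictConvexOn hm).2 hp.1.2.1 hq.1.2.1 hxy (by norm_num) (by norm_num) (by norm_num)
  have hfeas : P.IsFeasible ω (lam, (1 / 2 : ℝ) • x + (1 / 2 : ℝ) • y) := by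
    refine ⟨hp.1.1, P.convex_X hp.1.2.1 hq.1.2.1 (by norm_num) (by norm_num) (by norm_num), ?_⟩
    intro δ hδ
    have e1 := hp.1.2.2 δ hδ
    have e2 := hq.1.2.2 δ hδ
    simp only [inner_add_right, inner_smul_right] at e1 e2 ⊢
    linarith
  have hle := hp.2 _ hfeas
  rw [objective, objective, Prod.Lex.toLex_le_toLex] at hle
  rcases hle with h3 | ⟨-, h3⟩
  · exact lt_irrefl _ h3
  · simp only [smul_eq_mul] at hlt h3
    linarith

/-- The (unique) optimal solution of the sampled problem with constraint set `ω`. -/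
def opt (ω : Finset Δ) : ℝ × EuclideanSpace ℝ (Fin d) := (P.exists_isOptimal ω).choose

theorem isOptimal_opt (ω : Finset Δ) : P.IsOptimal ω (P.opt ω) :=
  (P.exists_isOptimal ω).choose_spec

/-- The optimal cost, compared lexicographically. -/
def cost (ω : Finset Δ) : ℝ ×ₗ ℝ := P.objective (P.opt ω)

/-- `β` is an essential set of the problem with constraint set `ω`: a subset of `ω` with the same
optimal cost, of minimal cardinality among all such subsets. -/
def IsEssential (ω β : Finset Δ) : Prop :=
  β ⊆ ω ∧ P.cost β = P.cost ω ∧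
    ∀ γ : Finset Δ, γ ⊆ ω → P.cost γ = P.cost ω → β.card ≤ γ.card

open Classical in
/-- The set of sampled constraints `{w i | i ∈ I}`. -/
def sampleSet {N : ℕ} (w : Fin N → Δ) (I : Finset (Fin N)) : Finset Δ := I.image w

/-- `w` is non-degenerate: there is exactly one set of indices whose constraints form an
essential set of the problem sampled at `w`. -/
def IsNondegenerate {N : ℕ} (w : Fin N → Δ) : Prop :=
  ∃! I : Finset (Fin N), P.IsEssential (sampleSet w Finset.univ) (sampleSet w I)

open Classical in
/-- The violating probability of the sample `w` with respect to the measure `μ` on `Δ`. -/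
def violation [MeasurableSpace Δ] (μ : Measure Δ) {N : ℕ} (w : Fin N → Δ) : ℝ :=
  μ.real {δ | P.cost (sampleSet w Finset.univ) < P.cost (insert δ (sampleSet w Finset.univ))}

end QuasiLinearProblem

/-- The regularized incomplete beta function `I_x(a, b)`. -/
def regIncompleteBeta (x a b : ℝ) : ℝ :=
  (∫ t in (0 : ℝ)..x, t ^ (a - 1) * (1 - t) ^ (b - 1)) / ProbabilityTheory.beta a b

/-- `Φ(ε, k, N) = I_{1-ε}(N - k, k + 1)` for `k < N`, which is the binomial tail
`∑ j ≤ k, (N choose j) ε^j (1-ε)^(N-j)`. -/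
def scenarioBeta (ε : ℝ) (k N : ℕ) : ℝ :=
  regIncompleteBeta (1 - ε) ((N : ℝ) - (k : ℝ)) ((k : ℝ) + 1)

end

/-!
For each sample the irreducible subfamilies with the optimal cost of the whole sample play the role
of essential sets. Such a subfamily always exists, and almost surely it is unique
(`QuasiLinearProblem.ae_eq_of_isIrreducible`). Non-degeneracy alone only says that the *smallest*
index set with the optimal cost is unique; that no larger one is irreducible follows by replacing
part of the sample with an independent copy
(`QuasiLinearProblem.ae_not_equivalent_of_card_lt`).

Let `F k` be the law of the violating probability of an irreducible sample of size `k`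
(`QuasiLinearProblem.irreducibleLaw`). By locality of the optimal cost, a given irreducible
subfamily of size `k` with violating probability `v` has the optimal cost of the whole sample of
size `M` with conditional probability `(1 - v) ^ (M - k)`. Hence, for all `M ≥ 1`,

`∑ k ≤ ζ, (M choose k) * ∫ v, (1 - v) ^ (M - k) ∂F k = 1`,

while the probability of a violation larger than `ε` for a sample of size `N` is at most
`∑ k ≤ ζ, (N choose k) * ∫ v in Ioi ε, (1 - v) ^ (N - k) ∂F k`. The bound on the latter is a matter of
linear programming duality. Weighting the identities with the coefficients of a polynomial `q`
with `q 0 = 0` gives `∑ k ≤ ζ, ∫ v, q⁽ᵏ⁾ (1 - v) / k! ∂F k = q 1`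
(`QuasiLinearProblem.sum_integral_hasseDeriv_eval`), so the probability is at most `q 1` as soon as
`q⁽ᵏ⁾` is nonnegative on `[0, 1]` and at least the `k`-th derivative of `t ^ N` on `[0, 1 - ε)`, for
all `k ≤ ζ`. The optimal `q` would be the function equal to `t ^ N` on `[0, 1 - ε]` and to its Taylor
polynomial of degree `ζ - 1` afterwards, whose value at `1` is `scenarioBeta ε (ζ - 1) N`. It is
approximated by polynomials obtained by integrating `ζ` times an upper approximation of its `ζ`-th
derivative (`exists_polynomial_hasseDeriv_ge`).
-/

noncomputable section

namespace QuasiLinearProblem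

variable {d : ℕ} {Δ : Type*} (P : QuasiLinearProblem d Δ)

/-! ### The optimal cost as a function of the constraint set -/

theorem IsFeasible.mono {P : QuasiLinearProblem d Δ} {F G : Finset Δ}
    {p : ℝ × EuclideanSpace ℝ (Fin d)} (h : P.IsFeasible G p) (hFG : F ⊆ G) :
    P.IsFeasible F p :=
  ⟨h.1, h.2.1, fun δ hδ => h.2.2 δ (hFG hδ)⟩

theorem cost_mono {F G : Finset Δ} (hFG : F ⊆ G) : P.cost F ≤ P.cost G :=
  (P.isOptimal_opt F).2 _ ((P.isOptimal_opt G).1.mono hFG)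

/-- Since optimal solutions are unique, adding constraints keeps the optimal cost only if it keeps
the optimal solution. -/
theorem opt_eq_of_cost_eq {F G : Finset Δ} (hFG : F ⊆ G) (h : P.cost G = P.cost F) :
    P.opt G = P.opt F := by
  refine IsOptimal.unique (P := P) (ω := F) ⟨(P.isOptimal_opt G).1.mono hFG, fun q hq => ?_⟩
    (P.isOptimal_opt F)
  exact (le_of_eq h).trans ((P.isOptimal_opt F).2 q hq)

theorem cost_eq_iff_isFeasible {F G : Finset Δ} (hFG : F ⊆ G) :
    P.cost G = P.cost F ↔ P.IsFeasible G (P.opt F) := by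
  refine ⟨fun h => P.opt_eq_of_cost_eq hFG h ▸ (P.isOptimal_opt G).1, fun h => ?_⟩
  exact le_antisymm ((P.isOptimal_opt G).2 _ h) (P.cost_mono hFG)

open Classical in
/-- The constraints which change the optimal cost when they are added to `F`. -/
def violatedSet (F : Finset Δ) : Set Δ := {δ | P.cost F < P.cost (insert δ F)}

theorem notMem_violatedSet_iff {F : Finset Δ} {δ : Δ} :
    δ ∉ P.violatedSet F ↔
      inner ℝ (P.a δ) (P.opt F).2 ≤ (P.opt F).1 * inner ℝ (P.b δ) (P.opt F).2 := by
  classical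
  have h1 : δ ∉ P.violatedSet F ↔ P.cost (insert δ F) = P.cost F := by
    have := P.cost_mono (Finset.subset_insert δ F)
    simp only [violatedSet, mem_ofPred_eq, not_lt]
    exact ⟨fun h => le_antisymm (by convert h) (by convert this), fun h => le_of_eq (by convert h)⟩
  rw [h1, P.cost_eq_iff_isFeasible (Finset.subset_insert δ F)]
  have h0 := (P.isOptimal_opt F).1
  constructor
  · exact fun h => h.2.2 δ (Finset.mem_insert_self _ _)
  · refine fun h => ⟨h0.1, h0.2.1, fun γ hγ => ?_⟩
    rcases Finset.mem_insert.1 hγ with rfl | hγ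
    exacts [h, h0.2.2 γ hγ]

/-- Locality: a set of constraints changes the optimal cost if and only if one of them alone
does. -/
theorem cost_eq_iff_forall_notMem {F G : Finset Δ} (hFG : F ⊆ G) :
    P.cost G = P.cost F ↔ ∀ δ ∈ G, δ ∉ P.violatedSet F := by
  simp only [P.cost_eq_iff_isFeasible hFG, notMem_violatedSet_iff]
  have h0 := (P.isOptimal_opt F).1
  exact ⟨fun h => h.2.2, fun h => ⟨h0.1, h0.2.1, h⟩⟩

theorem violatedSet_eq_of_cost_eq {F G : Finset Δ} (hFG : F ⊆ G) (h : P.cost G = P.cost F) :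
    P.violatedSet G = P.violatedSet F := by
  ext δ
  rw [← not_iff_not, notMem_violatedSet_iff, notMem_violatedSet_iff, P.opt_eq_of_cost_eq hFG h]

/-! ### Families of constraints -/

variable {ι κ : Type*}

open Classical in
/-- The optimal cost of the problem whose constraints are the `w i` with `i ∈ J`. -/
def costOn (w : ι → Δ) (J : Finset ι) : ℝ ×ₗ ℝ := P.cost (J.image w)

open Classical in
/-- The constraints violated by the optimal solution of the problem with constraints `w i`,
`i ∈ J`. -/
def violatedOn (w : ι → Δ) (J : Finset ι) : Set Δ := P.violatedSet (J.image w)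

/-- No proper subfamily of the constraints `w i`, `i ∈ J`, has the same optimal cost. -/
def IsIrreducible (w : ι → Δ) (J : Finset ι) : Prop :=
  ∀ K, K ⊂ J → P.costOn w K ≠ P.costOn w J

theorem costOn_mono (w : ι → Δ) {J K : Finset ι} (h : J ⊆ K) : P.costOn w J ≤ P.costOn w K := by
  classical
  exact P.cost_mono (Finset.image_mono w h)

theorem costOn_comp (w : ι → Δ) (e : κ ↪ ι) (J : Finset κ) :
    P.costOn (w ∘ e) J = P.costOn w (J.map e) := by
  classical
  simp only [costOn]
  congr 1
  ext; simp

theorem violatedOn_comp (w : ι → Δ) (e : κ ↪ ι) (J : Finset κ) :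
    P.violatedOn (w ∘ e) J = P.violatedOn w (J.map e) := by
  classical
  simp only [violatedOn]
  congr 1
  ext; simp

theorem isIrreducible_comp (w : ι → Δ) (e : κ ↪ ι) (J : Finset κ) :
    P.IsIrreducible (w ∘ e) J ↔ P.IsIrreducible w (J.map e) := by
  constructor
  · intro h K hK
    obtain ⟨K', hK', rfl⟩ := Finset.subset_map_iff.1 hK.1
    rw [← costOn_comp, ← costOn_comp]
    exact h K' (Finset.map_ssubset_map.1 hK)
  · intro h K hK
    rw [costOn_comp, costOn_comp]
    exact h _ (Finset.map_ssubset_map.2 hK)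

theorem costOn_eq_iff_forall_notMem (w : ι → Δ) {I J : Finset ι} (h : I ⊆ J) :
    P.costOn w J = P.costOn w I ↔ ∀ j ∈ J, w j ∉ P.violatedOn w I := by
  classical
  rw [costOn, costOn, P.cost_eq_iff_forall_notMem (Finset.image_mono w h)]
  simp [violatedOn]

theorem violatedOn_eq_of_costOn_eq (w : ι → Δ) {I J : Finset ι} (h : I ⊆ J)
    (hc : P.costOn w J = P.costOn w I) : P.violatedOn w J = P.violatedOn w I := by
  classical
  exact P.violatedSet_eq_of_cost_eq (Finset.image_mono w h) hc

theorem exists_isIrreducible (w : ι → Δ) (J : Finset ι) :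
    ∃ I ⊆ J, P.IsIrreducible w I ∧ P.costOn w J = P.costOn w I := by
  induction J using Finset.strongInduction with
  | H J ih =>
    by_cases h : P.IsIrreducible w J
    · exact ⟨J, subset_rfl, h, rfl⟩
    · simp only [IsIrreducible, not_forall, not_not] at h
      obtain ⟨K, hK, hc⟩ := h
      obtain ⟨I, hI, h1, h2⟩ := ih K hK
      exact ⟨I, hI.trans hK.1, h1, hc ▸ h2⟩

open Classical in
theorem exists_subset_image_eq_card_eq (w : ι → Δ) {J : Finset ι} {γ : Finset Δ}
    (h : γ ⊆ J.image w) : ∃ K ⊆ J, K.image w = γ ∧ K.card = γ.card := by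
  have hsurj : SurjOn w (J : Set ι) (γ : Set Δ) := by
    intro δ hδ
    simpa using Finset.mem_image.1 (h hδ)
  obtain ⟨s, hs, hbij⟩ := hsurj.exists_bijOn_subset
  lift s to Finset ι using J.finite_toSet.subset hs
  have him : s.image w = γ := by
    rw [← Finset.coe_inj, Finset.coe_image, hbij.image_eq]
  exact ⟨s, by exact_mod_cast hs, him, by rw [← him, Finset.card_image_of_injOn hbij.injOn]⟩

/-! ### Measurability of the optimal cost -/

/-- Solvability over a compact set of finitely many inequalities, continuous in the unknown and
measurable in the parameter, is a measurable condition on the parameter. -/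
theorem measurableSet_exists_mem_forall_le {Ω E : Type*} [MeasurableSpace Ω]
    [PseudoMetricSpace E] [SecondCountableTopology E] {K : Set E} (hK : IsCompact K)
    (J : Finset ι) (g : ι → Ω → E → ℝ) (hm : ∀ i x, Measurable fun ω => g i ω x)
    (hc : ∀ i ω, Continuous (g i ω)) :
    MeasurableSet {ω | ∃ x ∈ K, ∀ i ∈ J, g i ω x ≤ 0} := by
  -- The inequalities are collected in the single condition `G ω x ≤ 0`.
  set G : Ω → E → ℝ := fun ω x => ∑ i ∈ J, max (g i ω x) 0 with hG
  have hGc : ∀ ω, Continuous (G ω) := fun ω =>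
    continuous_finsetSum _ fun i _ => (hc i ω).max continuous_const
  have hGm : ∀ x, Measurable fun ω => G ω x := fun x =>
    Finset.measurable_fun_sum _ fun i _ => (hm i x).max measurable_const
  have hG0 : ∀ ω x, G ω x ≤ 0 ↔ ∀ i ∈ J, g i ω x ≤ 0 := by
    intro ω x
    have h0 : 0 ≤ G ω x := Finset.sum_nonneg fun i _ => le_max_right _ _
    rw [h0.ge_iff_eq', hG, Finset.sum_eq_zero_iff_of_nonneg fun i _ => le_max_right _ _]
    simp
  obtain ⟨Q, hQK, hQc, hQd⟩ :=
    (TopologicalSpace.IsSeparable.of_separableSpace K).exists_countable_dense_subset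
  have : {ω | ∃ x ∈ K, ∀ i ∈ J, g i ω x ≤ 0} = ⋂ n : ℕ, ⋃ x ∈ Q, {ω | G ω x < 1 / (n + 1)} := by
    ext ω
    simp only [mem_ofPred_eq, mem_iInter, mem_iUnion, ← hG0, exists_prop]
    constructor
    · rintro ⟨x, hx, hx0⟩ n
      have hU : IsOpen {y | G ω y < 1 / (n + 1)} := isOpen_lt (hGc ω) continuous_const
      obtain ⟨y, hy, hyQ⟩ := mem_closure_iff.1 (hQd hx) _ hU
        (hx0.trans_lt (by positivity : (0 : ℝ) < 1 / (n + 1)))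
      exact ⟨y, hyQ, hy⟩
    · intro h
      obtain ⟨y, hy, -⟩ := h 0
      obtain ⟨x, hx, hmin⟩ := hK.exists_isMinOn ⟨y, hQK hy⟩ (hGc ω).continuousOn
      refine ⟨x, hx, le_of_forall_pos_lt_add fun ε hε => ?_⟩
      obtain ⟨n, hn⟩ := exists_nat_one_div_lt hε
      obtain ⟨z, hz, hzn⟩ := h n
      have : G ω x ≤ G ω z := hmin (hQK hz)
      linarith
  rw [this]
  exact MeasurableSet.iInter fun n => MeasurableSet.biUnion hQc fun x _ =>
    measurableSet_lt (hGm x) measurable_const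

section Measurability

variable [MeasurableSpace Δ]
theorem measurableSet_exists_level_feasible (ha : Measurable P.a) (hb : Measurable P.b)
    {K : Set (EuclideanSpace ℝ (Fin d))}
    (hK : IsCompact K) (J : Finset ι) :
    MeasurableSet {q : (ι → Δ) × ℝ | ∃ x ∈ K, ∀ i ∈ J,
      inner ℝ (P.a (q.1 i)) x ≤ q.2 * inner ℝ (P.b (q.1 i)) x} := by
  have := measurableSet_exists_mem_forall_le hK J
    (fun i (q : (ι → Δ) × ℝ) x => inner ℝ (P.a (q.1 i)) x - q.2 * inner ℝ (P.b (q.1 i)) x)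
    (fun i x => by fun_prop) (fun i q => by fun_prop)
  simpa only [sub_nonpos] using this

theorem measurable_costOn_fst (ha : Measurable P.a) (hb : Measurable P.b)
    (J : Finset ι) :
    Measurable fun w : ι → Δ => (ofLex (P.costOn w J)).1 := by
  classical
  refine measurable_of_Iic fun r => ?_
  rcases lt_or_ge r 0 with hr | hr
  · convert MeasurableSet.empty
    ext w
    simp only [mem_preimage, mem_Iic, mem_empty_iff_false, iff_false, not_le]
    exact hr.trans_le (P.isOptimal_opt (J.image w)).1.1
  · convert (measurable_id.prodMk measurable_const) 
      (P.measurableSet_exists_level_feasible ha hb P.isCompact_X J) using 1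
    rotate_left
    · exact r
    ext w
    have h0 := P.isOptimal_opt (J.image w)
    simp only [mem_preimage, mem_Iic, mem_ofPred_eq, id]
    constructor
    · intro h
      refine ⟨_, h0.1.2.1, fun i hi => (h0.1.2.2 _ (Finset.mem_image_of_mem w hi)).trans ?_⟩
      exact mul_le_mul_of_nonneg_right h (P.b_pos _ _ h0.1.2.1).le
    · rintro ⟨x, hx, hxJ⟩
      have := h0.2 (r, x) ⟨hr, hx, by simpa using hxJ⟩
      rw [objective, objective, Prod.Lex.toLex_le_toLex] at this
      exact this.elim le_of_lt fun h => h.1.le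

theorem measurable_costOn_snd (ha : Measurable P.a) (hb : Measurable P.b)
    (J : Finset ι) :
    Measurable fun w : ι → Δ => (ofLex (P.costOn w J)).2 := by
  classical
  refine measurable_of_Iic fun s => ?_
  have hK : IsCompact {x | x ∈ P.X ∧ P.c x ≤ s} := by
    obtain ⟨v, hv, hXv⟩ := lowerSemicontinuousOn_iff_preimage_Iic.1 P.lsc_c s
    convert P.isCompact_X.inter_right hv using 1
    exact hXv
  convert (measurable_id.prodMk (P.measurable_costOn_fst ha hb J)) 
    (P.measurableSet_exists_level_feasible ha hb hK J) using 1
  ext w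
  have h0 := P.isOptimal_opt (J.image w)
  simp only [mem_preimage, mem_Iic, mem_ofPred_eq, id]
  constructor
  · intro h
    exact ⟨_, ⟨h0.1.2.1, h⟩, fun i hi => h0.1.2.2 _ (Finset.mem_image_of_mem w hi)⟩
  · rintro ⟨x, ⟨hx, hxs⟩, hxJ⟩
    have := h0.2 ((P.opt (J.image w)).1, x) ⟨h0.1.1, hx, Finset.forall_mem_image.2 hxJ⟩
    rw [objective, objective, Prod.Lex.toLex_le_toLex] at this
    rcases this with h | h
    · exact absurd h (lt_irrefl _)
    · exact h.2.trans hxs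

theorem measurableSet_costOn_eq (ha : Measurable P.a) (hb : Measurable P.b)
    (J K : Finset ι) :
    MeasurableSet {w : ι → Δ | P.costOn w J = P.costOn w K} := by
  have : {w : ι → Δ | P.costOn w J = P.costOn w K} =
      {w | (ofLex (P.costOn w J)).1 = (ofLex (P.costOn w K)).1} ∩
      {w | (ofLex (P.costOn w J)).2 = (ofLex (P.costOn w K)).2} := by
    ext w
    simp only [mem_inter_iff, mem_ofPred_eq, ← Prod.ext_iff, ofLex_inj]
  rw [this]
  exact (measurableSet_eq_fun (P.measurable_costOn_fst ha hb J)
    (P.measurable_costOn_fst ha hb K)).inter (measurableSet_eq_fun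
    (P.measurable_costOn_snd ha hb J) (P.measurable_costOn_snd ha hb K))

theorem measurableSet_isIrreducible (ha : Measurable P.a) (hb : Measurable P.b)
    (J : Finset ι) :
    MeasurableSet {w : ι → Δ | P.IsIrreducible w J} := by
  classical
  have : {w : ι → Δ | P.IsIrreducible w J} =
      ⋂ K ∈ J.ssubsets, {w | P.costOn w K = P.costOn w J}ᶜ := by
    ext w
    simp [IsIrreducible]
  rw [this]
  exact Finset.measurableSet_biInter _ fun K _ => (P.measurableSet_costOn_eq ha hb K J).compl

/-- The violation relation is jointly measurable in the family and the new constraint. -/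
theorem measurableSet_mem_violatedOn (ha : Measurable P.a) (hb : Measurable P.b)
    (J : Finset ι) :
    MeasurableSet {q : (ι → Δ) × Δ | q.2 ∈ P.violatedOn q.1 J} := by
  classical
  let f : (ι → Δ) × Δ → Option ι → Δ := fun q o => o.elim q.2 q.1
  have hf : Measurable f := measurable_pi_iff.2 fun o => by
    cases o with
    | none => exact measurable_snd
    | some i => exact (measurable_pi_apply i).comp measurable_fst
  convert hf (P.measurableSet_costOn_eq ha hb (J.map .some) (Finset.insertNone J)).compl using 1
  ext q
  have h1 : P.costOn (f q) (J.map .some) = P.cost (J.image q.1) := by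
    simp only [costOn]; congr 1; ext; simp [f]
  have h2 : P.costOn (f q) (Finset.insertNone J) = P.cost (insert q.2 (J.image q.1)) := by
    simp only [costOn]; congr 1; ext
    simp [f, Finset.insertNone]
  have := P.cost_mono (Finset.subset_insert q.2 (J.image q.1))
  simp only [mem_ofPred_eq, mem_preimage, mem_compl_iff, h1, h2, violatedOn, violatedSet]
  exact this.lt_iff_ne

end Measurability

end QuasiLinearProblem

end

noncomputable section

/-! ### Independent samples -/

section Product

variable {Δ : Type*} [MeasurableSpace Δ] (μ : Measure Δ) [IsProbabilityMeasure μ]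

theorem measurePreserving_comp_embedding {κ : Type*} [Fintype κ] (e : κ ↪ ℕ) :
    MeasurePreserving (fun ω : ℕ → Δ => ω ∘ e) (Measure.infinitePi fun _ : ℕ => μ)
      (Measure.pi fun _ : κ => μ) := by
  classical
  have hm : Measurable (fun ω : ℕ → Δ => ω ∘ e) :=
    measurable_pi_iff.2 fun i => measurable_pi_apply (e i)
  refine ⟨hm, (Measure.pi_eq fun s hs => ?_).symm⟩
  rw [Measure.map_apply hm (MeasurableSet.univ_pi hs)]
  have h1 : (fun ω : ℕ → Δ => ω ∘ e) ⁻¹' univ.pi s =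
      Set.pi (Finset.univ.map e) (fun j => ⋂ i, ⋂ (_ : e i = j), s i) := by
    ext ω
    simp [Set.mem_pi]
  rw [h1, Measure.infinitePi_pi _ fun j _ => MeasurableSet.iInter fun i =>
    MeasurableSet.iInter fun _ => hs i, Finset.prod_map]
  refine Finset.prod_congr rfl fun i _ => ?_
  congr 1
  ext x
  simp

theorem measurePreserving_comp_sum_embedding {α β : Type*} [Fintype α] [Fintype β]
    (e : α ⊕ β ↪ ℕ) :
    MeasurePreserving (fun ω : ℕ → Δ => (ω ∘ e ∘ Sum.inl, ω ∘ e ∘ Sum.inr))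
      (Measure.infinitePi fun _ : ℕ => μ)
      ((Measure.pi fun _ : α => μ).prod (Measure.pi fun _ : β => μ)) :=
  (measurePreserving_sumPiEquivProdPi fun _ : α ⊕ β => μ).comp
    (measurePreserving_comp_embedding μ e)

/-- If, given `x`, two independent copies of `y` almost surely do not both satisfy a condition
together with `x`, then a single copy almost surely does not: the conditional probability of the
former event is the square of that of the latter. -/
theorem ae_notMem_of_ae_notMem_copies {X Y : Type*} [MeasurableSpace X] [MeasurableSpace Y]
    (μ : Measure X) (ν : Measure Y) [SFinite μ] [SFinite ν] {E : Set (X × Y)}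
    (hE : MeasurableSet E)
    (h : ∀ᵐ q ∂μ.prod (ν.prod ν), ¬((q.1, q.2.1) ∈ E ∧ (q.1, q.2.2) ∈ E)) :
    ∀ᵐ q ∂μ.prod ν, q ∉ E := by
  have hE2 : MeasurableSet {q : X × Y × Y | (q.1, q.2.1) ∈ E ∧ (q.1, q.2.2) ∈ E} :=
    (((measurable_fst.prodMk (measurable_fst.comp measurable_snd))) hE).inter
      ((measurable_fst.prodMk (measurable_snd.comp measurable_snd)) hE)
  rw [ae_iff] at h ⊢
  simp only [not_not] at h ⊢
  change (μ.prod ν) E = 0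
  rw [Measure.measure_prod_null hE2] at h
  rw [Measure.measure_prod_null hE]
  filter_upwards [h] with x hx
  have : Prod.mk x ⁻¹' {q : X × Y × Y | (q.1, q.2.1) ∈ E ∧ (q.1, q.2.2) ∈ E} =
      (Prod.mk x ⁻¹' E) ×ˢ (Prod.mk x ⁻¹' E) := rfl
  rw [this, Measure.prod_prod] at hx
  simpa using hx

/-- The version of `ae_notMem_of_ae_notMem_copies` for an infinite sample, whose entries at the
indices in `α` take the place of `x`. -/
theorem ae_comp_notMem_of_copies {α β : Type*} [Fintype α] [Fintype β] (e : α ⊕ β ⊕ β ↪ ℕ)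
    {E : Set (α ⊕ β → Δ)} (hE : MeasurableSet E)
    (h : ∀ᵐ ω ∂(Measure.infinitePi fun _ : ℕ => μ),
      ¬(ω ∘ e ∘ Sum.map id Sum.inl ∈ E ∧ ω ∘ e ∘ Sum.map id Sum.inr ∈ E)) :
    ∀ᵐ ω ∂(Measure.infinitePi fun _ : ℕ => μ), ω ∘ e ∘ Sum.map id Sum.inl ∉ E := by
  let φ := (MeasurableEquiv.sumPiEquivProdPi fun _ : α ⊕ β => Δ).symm
  have mp3 : MeasurePreserving (fun ω : ℕ → Δ =>
      (ω ∘ e ∘ Sum.inl, (ω ∘ e ∘ Sum.inr ∘ Sum.inl, ω ∘ e ∘ Sum.inr ∘ Sum.inr)))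
      (Measure.infinitePi fun _ : ℕ => μ)
      ((Measure.pi fun _ : α => μ).prod
        ((Measure.pi fun _ : β => μ).prod (Measure.pi fun _ : β => μ))) :=
    ((MeasurePreserving.id _).prod (measurePreserving_sumPiEquivProdPi fun _ : β ⊕ β => μ)).comp
      (measurePreserving_comp_sum_embedding μ e)
  have mp2 := measurePreserving_comp_sum_embedding μ
    ((Function.Embedding.sumMap (.refl α) (.inl : β ↪ β ⊕ β)).trans e)
  have hφ (x : α → Δ) (y : β → Δ) : φ (x, y) = Sum.elim x y := by
    ext (i | i) <;> rfl
  have key := ae_notMem_of_ae_notMem_copies (Measure.pi fun _ : α => μ)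
    (Measure.pi fun _ : β => μ) (E := φ ⁻¹' E) (φ.measurable hE) ?_
  · filter_upwards [mp2.quasiMeasurePreserving.ae key] with ω hω hω'
    apply hω
    rw [mem_preimage, hφ]
    convert hω' using 1
    ext (i | i) <;> rfl
  · rw [← mp3.map_eq]
    have hφE : MeasurableSet (φ ⁻¹' E) := φ.measurable hE
    rw [ae_map_iff mp3.measurable.aemeasurable]
    · filter_upwards [h] with ω hω hω'
      simp only [mem_preimage, hφ] at hω'
      apply hω
      convert hω' using 2 <;> ext (i | i) <;> rfl
    · exact ((((measurable_fst.prodMk (measurable_fst.comp measurable_snd))) hφE).inter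
        ((measurable_fst.prodMk (measurable_snd.comp measurable_snd)) hφE)).compl

end Product

namespace QuasiLinearProblem

variable {d : ℕ} {Δ : Type*} (P : QuasiLinearProblem d Δ)

/-! ### Uniqueness of the irreducible subfamily -/

/-- Non-degeneracy in terms of indices: there is exactly one index set of least cardinality with
the optimal cost of the whole sample. The constraints attached to it are distinct, because an
essential set may be indexed without repetition. -/
theorem IsNondegenerate.exists_card_min {P : QuasiLinearProblem d Δ} {N : ℕ} {w : Fin N → Δ}
    (h : P.IsNondegenerate w) :
    ∃ I : Finset (Fin N), P.costOn w Finset.univ = P.costOn w I ∧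
      ∀ J, P.costOn w Finset.univ = P.costOn w J → I.card ≤ J.card ∧ (J.card = I.card → J = I) := by
  classical
  obtain ⟨I, ⟨hsub, hcost, hmin⟩, huniq⟩ := h
  have hc (J : Finset (Fin N)) : P.cost (sampleSet w J) = P.costOn w J := by
    simp only [costOn, sampleSet]
  rw [hc, hc] at hcost
  have hle (J) (hJ : P.costOn w Finset.univ = P.costOn w J) :
      (sampleSet w I).card ≤ (sampleSet w J).card := by
    refine hmin _ ?_ (by rw [hc, hc, hJ])
    exact Finset.image_mono w (Finset.subset_univ J)
  have hcard (J : Finset (Fin N)) : (sampleSet w J).card ≤ J.card := Finset.card_image_le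
  have hess (J) (hJ : P.costOn w Finset.univ = P.costOn w J)
      (hJc : J.card ≤ (sampleSet w I).card) : J = I := by
    refine huniq J ⟨Finset.image_mono w (Finset.subset_univ J), by rw [hc, hc, hJ], ?_⟩
    exact fun γ hγ hγc => ((hcard J).trans hJc).trans (hmin γ hγ hγc)
  have hI : (sampleSet w I).card = I.card := by
    obtain ⟨K, hK, hKi, hKc⟩ := exists_subset_image_eq_card_eq w
      (J := I) (γ := sampleSet w I) (le_of_eq rfl)
    have : K = I := by
      refine hess K ?_ hKc.le
      rw [← hcost, ← hc I, ← hKi]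
      simp only [costOn]
    rw [← hKc, this]
  refine ⟨I, hcost.symm, fun J hJ => ⟨?_, fun h => hess J hJ (by rw [hI, h])⟩⟩
  rw [← hI]
  exact (hle J hJ).trans (hcard J)

variable [MeasurableSpace Δ] (μ : Measure Δ) [IsProbabilityMeasure μ]

theorem ae_exists_card_min
    (hnondeg : ∀ N : ℕ, 1 ≤ N →
      ∀ᵐ w ∂(Measure.pi fun _ : Fin N => μ), P.IsNondegenerate w)
    {T : Finset ℕ} (hT : T.Nonempty) :
    ∀ᵐ ω ∂(Measure.infinitePi fun _ : ℕ => μ), ∃ I ⊆ T, P.costOn ω T = P.costOn ω I ∧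
      ∀ J ⊆ T, P.costOn ω T = P.costOn ω J → I.card ≤ J.card ∧ (J.card = I.card → J = I) := by
  let e : Fin T.card ↪ ℕ := (T.orderEmbOfFin rfl).toEmbedding
  have he : Finset.univ.map e = T := by
    ext i; simp [e]
  filter_upwards [(measurePreserving_comp_embedding μ e).quasiMeasurePreserving.ae
    (hnondeg T.card hT.card_pos)] with ω hω
  obtain ⟨I, hI, hmin⟩ := hω.exists_card_min
  simp only [costOn_comp, he] at hI hmin
  refine ⟨I.map e, (Finset.map_subset_map.2 (Finset.subset_univ I)).trans he.le, hI,
    fun J hJ hJc => ?_⟩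
  rw [← he] at hJ
  obtain ⟨J, -, rfl⟩ := Finset.subset_map_iff.1 hJ
  have := hmin J hJc
  simpa using this

/-- Almost surely, an irreducible family has no equivalent family with fewer constraints. If there
were one, `J`, with positive probability, then, conditionally on the constraints in `I`, an
independent copy of the constraints in `J \ I` would do as well as the original ones. Both versions
of `J` being equivalent to their union with `I`, uniqueness of the smallest equivalent family
produces a still smaller one. -/
theorem ae_not_equivalent_of_card_lt (ha : Measurable P.a) (hb : Measurable P.b)
    (hnondeg : ∀ N : ℕ, 1 ≤ N →
      ∀ᵐ w ∂(Measure.pi fun _ : Fin N => μ), P.IsNondegenerate w)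
    {I J : Finset ℕ} (hIJ : J.card < I.card) :
    ∀ᵐ ω ∂(Measure.infinitePi fun _ : ℕ => μ), ¬(P.IsIrreducible ω I ∧
      P.costOn ω (I ∪ J) = P.costOn ω I ∧ P.costOn ω (I ∪ J) = P.costOn ω J) := by
  induction hn : J.card using Nat.strong_induction_on generalizing J with
  | _ n ih =>
  subst hn
  -- If `J ⊆ I`, the equality of the costs contradicts irreducibility.
  by_cases hsub : J ⊆ I
  · refine .of_forall fun ω h => h.1 J ⟨hsub, fun h' => ?_⟩ (h.2.2.symm.trans h.2.1)
    exact absurd (Finset.card_le_card h') (not_le.2 hIJ)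
  obtain ⟨c, hcJ, hcI⟩ := Finset.not_subset.1 hsub
  let m := (I ∪ J).sup id + 1
  have hm : ∀ i ∈ I ∪ J, i < m := fun i hi => Nat.lt_succ_of_le (Finset.le_sup (f := id) hi)
  -- The index set `J \ I` and its translate by `m` carry the two copies.
  let e : I ⊕ (J \ I : Finset ℕ) ⊕ (J \ I : Finset ℕ) ↪ ℕ :=
    ⟨Sum.elim (fun i => i) (Sum.elim (fun i => i) fun i => i + m), by
      rintro (⟨i, hi⟩ | ⟨i, hi⟩ | ⟨i, hi⟩) (⟨j, hj⟩ | ⟨j, hj⟩ | ⟨j, hj⟩) h <;>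
      have h1 := hm i (by grind) <;> have h2 := hm j (by grind) <;> grind⟩
  let e₁ : I ⊕ (J \ I : Finset ℕ) ↪ ℕ :=
    (Function.Embedding.sumMap (.refl I) (.inl : _ ↪ (J \ I : Finset ℕ) ⊕ _)).trans e
  let e₂ : I ⊕ (J \ I : Finset ℕ) ↪ ℕ :=
    (Function.Embedding.sumMap (.refl I) (.inr : _ ↪ (J \ I : Finset ℕ) ⊕ _)).trans e
  let II : Finset (I ⊕ (J \ I : Finset ℕ)) := Finset.univ.map .inl
  let JJ : Finset (I ⊕ (J \ I : Finset ℕ)) := Finset.univ.filter fun i => e₁ i ∈ J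
  have h₁l (x) : e₁ (.inl x) = x := rfl
  have h₁r (x) : e₁ (.inr x) = x := rfl
  have h₂l (x) : e₂ (.inl x) = x := rfl
  have hI₁ : II.map e₁ = I := by
    ext i; simp [II, h₁l]
  have hI₂ : II.map e₂ = I := by
    ext i; simp [II, h₂l]
  have hJ₁ : JJ.map e₁ = J := by
    ext i
    simp only [JJ, Finset.mem_map, Finset.mem_filter_univ]
    constructor
    · rintro ⟨x, hx, rfl⟩
      exact hx
    · intro h
      by_cases hi : i ∈ I
      · exact ⟨.inl ⟨i, hi⟩, h, rfl⟩
      · exact ⟨.inr ⟨i, Finset.mem_sdiff.2 ⟨h, hi⟩⟩, h, rfl⟩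
  let E : Set (I ⊕ (J \ I : Finset ℕ) → Δ) := {z | P.IsIrreducible z II ∧
    P.costOn z (II ∪ JJ) = P.costOn z II ∧ P.costOn z (II ∪ JJ) = P.costOn z JJ}
  have hE : MeasurableSet E := (P.measurableSet_isIrreducible ha hb II).inter
    ((P.measurableSet_costOn_eq ha hb _ _).inter (P.measurableSet_costOn_eq ha hb _ _))
  have hE₁ (ω : ℕ → Δ) : ω ∘ e ∘ Sum.map id Sum.inl ∈ E ↔ P.IsIrreducible ω I ∧
      P.costOn ω (I ∪ J) = P.costOn ω I ∧ P.costOn ω (I ∪ J) = P.costOn ω J := by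
    have : ω ∘ e ∘ Sum.map id Sum.inl = ω ∘ e₁ := rfl
    simp only [this, E, mem_ofPred_eq, costOn_comp, isIrreducible_comp, Finset.map_union, hI₁, hJ₁]
  set J' := JJ.map e₂ with hJ'
  have hE₂ (ω : ℕ → Δ) : ω ∘ e ∘ Sum.map id Sum.inr ∈ E ↔ P.IsIrreducible ω I ∧
      P.costOn ω (I ∪ J') = P.costOn ω I ∧ P.costOn ω (I ∪ J') = P.costOn ω J' := by
    have : ω ∘ e ∘ Sum.map id Sum.inr = ω ∘ e₂ := rfl
    simp only [this, E, mem_ofPred_eq, costOn_comp, isIrreducible_comp, Finset.map_union, hI₂, hJ']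
  have hcard : J'.card = J.card := by
    rw [hJ', Finset.card_map, ← Finset.card_map e₁, hJ₁]
  have hne : c ∉ J' := by
    have hcm := hm c (Finset.mem_union_right _ hcJ)
    rw [hJ', Finset.mem_map]
    rintro ⟨⟨i, hi⟩ | ⟨i, hi⟩, -, h⟩
    · exact hcI ((show i = c from h) ▸ hi)
    · have : i + m = c := h
      omega
  simp only [← hE₁]
  refine ae_comp_notMem_of_copies μ e hE ?_
  have hsmall : ∀ᵐ ω ∂(Measure.infinitePi fun _ : ℕ => μ), ∀ K ∈ (I ∪ J ∪ J').powerset,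
      K.card < J.card → ¬(P.IsIrreducible ω I ∧
      P.costOn ω (I ∪ K) = P.costOn ω I ∧ P.costOn ω (I ∪ K) = P.costOn ω K) := by
    rw [Filter.eventually_all_finset]
    intro K _
    by_cases hK : K.card < J.card
    · filter_upwards [ih K.card hK (hK.trans hIJ) rfl] with ω hω _ using hω
    · exact .of_forall fun ω h => absurd h hK
  filter_upwards [hsmall, P.ae_exists_card_min μ hnondeg (T := I ∪ J ∪ J')
    ⟨c, by simp [hcJ]⟩] with ω hω ⟨K, hKT, hKc, hKmin⟩
  rw [hE₁, hE₂]
  rintro ⟨⟨hirr, h1, h2⟩, -, h3, h4⟩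
  -- None of the constraints in `J` or `J'` is violated by the solution for `I`.
  have hT : P.costOn ω (I ∪ J ∪ J') = P.costOn ω I := by
    rw [costOn_eq_iff_forall_notMem _ _ (by grind)] at h1 h3 ⊢
    grind
  have hJmin := hKmin J (by grind) (by rw [hT, ← h1, h2])
  have hJ'min := hKmin J' (by grind) (by rw [hT, ← h3, h4])
  rcases hJmin.1.lt_or_eq with h | h
  · have hIK : P.costOn ω (I ∪ K) = P.costOn ω I :=
      le_antisymm ((P.costOn_mono ω (by grind)).trans hT.le) (P.costOn_mono ω (by grind))
    exact hω K (Finset.mem_powerset.2 hKT) h ⟨hirr, hIK, by rw [hIK, ← hT, hKc]⟩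
  · have e1 := hJmin.2 h.symm
    have e2 := hJ'min.2 (by rw [hcard, h])
    exact hne (e2.trans e1.symm ▸ hcJ)

/-- Almost surely an irreducible subfamily with the optimal cost of the whole sample is the one of
least cardinality, so there is only one. -/
theorem ae_eq_of_isIrreducible (ha : Measurable P.a) (hb : Measurable P.b)
    (hnondeg : ∀ N : ℕ, 1 ≤ N →
      ∀ᵐ w ∂(Measure.pi fun _ : Fin N => μ), P.IsNondegenerate w)
    {T : Finset ℕ} (hT : T.Nonempty) :
    ∀ᵐ ω ∂(Measure.infinitePi fun _ : ℕ => μ), ∀ I ⊆ T, ∀ J ⊆ T,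
      P.IsIrreducible ω I → P.costOn ω T = P.costOn ω I →
      P.IsIrreducible ω J → P.costOn ω T = P.costOn ω J → I = J := by
  have hsmall : ∀ᵐ ω ∂(Measure.infinitePi fun _ : ℕ => μ), ∀ q ∈ T.powerset ×ˢ T.powerset,
      q.2.card < q.1.card → ¬(P.IsIrreducible ω q.1 ∧
      P.costOn ω (q.1 ∪ q.2) = P.costOn ω q.1 ∧ P.costOn ω (q.1 ∪ q.2) = P.costOn ω q.2) := by
    rw [Filter.eventually_all_finset]
    intro q _
    by_cases hq : q.2.card < q.1.card
    · filter_upwards [P.ae_not_equivalent_of_card_lt μ ha hb hnondeg hq] with ω hω _ using hω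
    · exact .of_forall fun ω h => absurd h hq
  filter_upwards [hsmall, P.ae_exists_card_min μ hnondeg hT] with ω hω ⟨K, hKT, hKc, hKmin⟩
  have key (I) (hI : I ⊆ T) (hirr : P.IsIrreducible ω I) (hc : P.costOn ω T = P.costOn ω I) :
      I = K := by
    have := hKmin I hI hc
    refine this.2 (this.1.eq_or_lt.elim Eq.symm fun h => ?_)
    have hIK : P.costOn ω (I ∪ K) = P.costOn ω I :=
      le_antisymm ((P.costOn_mono ω (by grind)).trans hc.le) (P.costOn_mono ω (by grind))
    exact absurd ⟨hirr, hIK, by rw [hIK, ← hc, hKc]⟩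
      (hω (I, K) (Finset.mk_mem_product (Finset.mem_powerset.2 hI) (Finset.mem_powerset.2 hKT)) h)
  intro I hI J hJ h1 h2 h3 h4
  rw [key I hI h1 h2, key J hJ h3 h4]

end QuasiLinearProblem

end

noncomputable section

namespace QuasiLinearProblem

variable {d : ℕ} {Δ : Type*} (P : QuasiLinearProblem d Δ)

variable [MeasurableSpace Δ] (μ : Measure Δ)

/-! ### The law of the violating probability of an irreducible sample -/

/-- The law of the violating probability of a sample of size `k`, restricted to the event that the
sample is irreducible. This is a measure of mass at most one. -/
def irreducibleLaw (k : ℕ) : Measure ℝ :=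
  ((Measure.pi fun _ : Fin k => μ).restrict {u | P.IsIrreducible u Finset.univ}).map
    fun u => μ.real (P.violatedOn u Finset.univ)

/-- An irreducible sample of size `k` gives rise to an essential set with `k` elements. -/
theorem irreducibleLaw_eq_zero_of_lt {ζ : ℕ}
    (hζ : ∀ ω β : Finset Δ, P.IsEssential ω β → β.card ≤ ζ) {k : ℕ} (hk : ζ < k) :
    P.irreducibleLaw μ k = 0 := by
  classical
  have : {u : Fin k → Δ | P.IsIrreducible u Finset.univ} = ∅ := by
    rw [eq_empty_iff_forall_notMem]
    intro u hu
    have key (γ : Finset Δ) (hγ : γ ⊆ Finset.univ.image u)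
        (hc : P.cost γ = P.cost (Finset.univ.image u)) : γ.card = k := by
      obtain ⟨K, hK, rfl, hKc⟩ := exists_subset_image_eq_card_eq u hγ
      by_cases h : K = Finset.univ
      · rw [← hKc, h, Finset.card_univ, Fintype.card_fin]
      · exact absurd hc (hu K (Finset.ssubset_univ_iff.2 h))
    have hess : P.IsEssential (Finset.univ.image u) (Finset.univ.image u) :=
      ⟨subset_rfl, rfl, fun γ hγ hc => by rw [key _ subset_rfl rfl, key γ hγ hc]⟩
    have := hζ _ _ hess
    rw [key _ subset_rfl rfl] at this
    omega
  rw [irreducibleLaw, this]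
  simp

/-- Sums over the index sets of a sample, grouped by size: irreducible samples have size at most
`ζ`. -/
theorem sum_powerset_integral_irreducibleLaw {ζ : ℕ}
    (hζ : ∀ ω β : Finset Δ, P.IsEssential ω β → β.card ≤ ζ) (M : ℕ) (A : Set ℝ) :
    ∑ I ∈ (Finset.range M).powerset, ∫ v in A, (1 - v) ^ (M - I.card) ∂P.irreducibleLaw μ I.card =
    ∑ k ∈ Finset.range (ζ + 1),
      (M.choose k : ℝ) * ∫ v in A, (1 - v) ^ (M - k) ∂P.irreducibleLaw μ k := by
  rw [Finset.sum_powerset_apply_card fun k => ∫ v in A, (1 - v) ^ (M - k) ∂P.irreducibleLaw μ k]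
  simp only [Finset.card_range, nsmul_eq_mul]
  have h1 : Finset.range (M + 1) ⊆ Finset.range (max M ζ + 1) :=
    Finset.range_mono (by omega)
  have h2 : Finset.range (ζ + 1) ⊆ Finset.range (max M ζ + 1) :=
    Finset.range_mono (by omega)
  rw [Finset.sum_subset h1, Finset.sum_subset h2]
  · intro k _ hk
    rw [Finset.mem_range, not_lt] at hk
    simp [P.irreducibleLaw_eq_zero_of_lt μ hζ hk]
  · intro k _ hk
    rw [Finset.mem_range, not_lt] at hk
    simp [Nat.choose_eq_zero_of_lt hk]

variable [IsProbabilityMeasure μ]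

instance (k : ℕ) : IsFiniteMeasure (P.irreducibleLaw μ k) := by
  unfold irreducibleLaw; infer_instance

theorem measurable_measureReal_violatedOn {ι : Type*} (ha : Measurable P.a) (hb : Measurable P.b)
    (J : Finset ι) : Measurable fun w : ι → Δ => μ.real (P.violatedOn w J) :=
  (measurable_measure_prodMk_left (ν := μ)
    (P.measurableSet_mem_violatedOn ha hb J)).ennreal_toReal

theorem ae_mem_Icc_irreducibleLaw (ha : Measurable P.a) (hb : Measurable P.b) (k : ℕ) :
    ∀ᵐ v ∂P.irreducibleLaw μ k, v ∈ Icc (0 : ℝ) 1 := by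
  refine (ae_map_iff (P.measurable_measureReal_violatedOn μ ha hb _).aemeasurable
    measurableSet_Icc).2 ?_
  exact .of_forall fun u => ⟨measureReal_nonneg, measureReal_le_one⟩

theorem integrable_irreducibleLaw (ha : Measurable P.a) (hb : Measurable P.b) (k : ℕ)
    {f : ℝ → ℝ} (hf : Continuous f) : Integrable f (P.irreducibleLaw μ k) := by
  rw [← Measure.restrict_eq_self_of_ae_mem (P.ae_mem_Icc_irreducibleLaw μ ha hb k)]
  exact hf.integrableOn_Icc

/-- Given an irreducible subfamily `I` of the sample `T`, its optimal cost is that of the whole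
sample precisely if none of the remaining `T.card - I.card` constraints is violated, and these are
independent of those in `I`. -/
theorem measureReal_isIrreducible_and_costOn_eq (ha : Measurable P.a) (hb : Measurable P.b)
    {I T : Finset ℕ} (hIT : I ⊆ T) {A : Set ℝ} (hA : MeasurableSet A) :
    (Measure.infinitePi fun _ : ℕ => μ).real {ω | P.IsIrreducible ω I ∧
      P.costOn ω T = P.costOn ω I ∧ μ.real (P.violatedOn ω I) ∈ A} =
    ∫ v in A, (1 - v) ^ (T.card - I.card) ∂P.irreducibleLaw μ I.card := by
  let o : Fin I.card ↪ ℕ := (I.orderEmbOfFin rfl).toEmbedding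
  have ho : Finset.univ.map o = I := by
    ext i; simp [o]
  have hoI (i) : o i ∈ I := I.orderEmbOfFin_mem rfl i
  let e : Fin I.card ⊕ (T \ I : Finset ℕ) ↪ ℕ :=
    ⟨Sum.elim o (fun i => i), by
      rintro (i | ⟨i, hi⟩) (j | ⟨j, hj⟩) h
      · exact congrArg _ (o.injective h)
      · exact absurd ((show o i = j from h) ▸ hoI i) (Finset.mem_sdiff.1 hj).2
      · exact absurd ((show i = o j from h) ▸ hoI j) (Finset.mem_sdiff.1 hi).2
      · exact congrArg _ (Subtype.ext h)⟩
  let V : (Fin I.card → Δ) → ℝ := fun u => μ.real (P.violatedOn u Finset.univ)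
  let S : Set (Fin I.card → Δ) := {u | P.IsIrreducible u Finset.univ}
  have hV : Measurable V := P.measurable_measureReal_violatedOn μ ha hb _
  have hS : MeasurableSet S := P.measurableSet_isIrreducible ha hb _
  have hviol := P.measurableSet_mem_violatedOn ha hb (Finset.univ : Finset (Fin I.card))
  let E : Set ((Fin I.card → Δ) × ((T \ I : Finset ℕ) → Δ)) :=
    {q | q.1 ∈ S ∩ V ⁻¹' A ∧ ∀ j, q.2 j ∉ P.violatedOn q.1 Finset.univ}
  have hE : MeasurableSet E := by
    have h : {q : (Fin I.card → Δ) × ((T \ I : Finset ℕ) → Δ) |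
        ∀ j, q.2 j ∉ P.violatedOn q.1 Finset.univ} =
        ⋂ j, (fun q : (Fin I.card → Δ) × ((T \ I : Finset ℕ) → Δ) => (q.1, q.2 j)) ⁻¹'
          {q : (Fin I.card → Δ) × Δ | q.2 ∈ P.violatedOn q.1 Finset.univ}ᶜ := by
      ext q; simp
    refine (measurable_fst (hS.inter (hV hA))).inter ?_
    change MeasurableSet {q : (Fin I.card → Δ) × ((T \ I : Finset ℕ) → Δ) |
      ∀ j, q.2 j ∉ P.violatedOn q.1 Finset.univ}
    rw [h]
    exact MeasurableSet.iInter fun j => (by fun_prop : Measurable _) hviol.compl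
  have hpre : {ω : ℕ → Δ | P.IsIrreducible ω I ∧
      P.costOn ω T = P.costOn ω I ∧ μ.real (P.violatedOn ω I) ∈ A} =
      (fun ω : ℕ → Δ => (ω ∘ e ∘ Sum.inl, ω ∘ e ∘ Sum.inr)) ⁻¹' E := by
    ext ω
    have h1 : ω ∘ e ∘ Sum.inl = ω ∘ o := rfl
    have h2 : (∀ j ∈ T, ω j ∉ P.violatedOn ω I) ↔
        ∀ j : (T \ I : Finset ℕ), ω j ∉ P.violatedOn ω I := by
      have := (P.costOn_eq_iff_forall_notMem ω (subset_refl I)).1 rfl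
      refine ⟨fun h j => h j (Finset.mem_sdiff.1 j.2).1, fun h j hj => ?_⟩
      by_cases hjI : j ∈ I
      · exact this j hjI
      · exact h ⟨j, Finset.mem_sdiff.2 ⟨hj, hjI⟩⟩
    simp only [mem_ofPred_eq, mem_preimage, E, S, V, mem_inter_iff, h1, isIrreducible_comp,
      violatedOn_comp, ho, P.costOn_eq_iff_forall_notMem ω hIT, h2]
    have h3 : ∀ j, (ω ∘ e ∘ Sum.inr) j = ω j := fun _ => rfl
    simp only [h3]
    tauto
  have hsec (u : Fin I.card → Δ) :
      ((Measure.pi fun _ : (T \ I : Finset ℕ) => μ) (Prod.mk u ⁻¹' E)).toReal =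
      S.indicator (fun u => A.indicator (fun v => (1 - v) ^ (T.card - I.card)) (V u)) u := by
    by_cases hu : u ∈ S ∩ V ⁻¹' A
    · have : Prod.mk u ⁻¹' E = univ.pi fun _ => (P.violatedOn u Finset.univ)ᶜ := by
        ext v
        simp only [E, mem_preimage, mem_ofPred_eq, hu, true_and, mem_univ_pi, mem_compl_iff]
      have hm : MeasurableSet (P.violatedOn u Finset.univ) := measurable_prodMk_left hviol
      rw [this, Measure.pi_pi, indicator_of_mem hu.1,
        indicator_of_mem (s := A) hu.2,
        Finset.prod_const, ENNReal.toReal_pow, ← Measure.real, probReal_compl_eq_one_sub hm]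
      simp [Finset.card_sdiff_of_subset hIT, V]
    · have : Prod.mk u ⁻¹' E = ∅ := by
        ext v
        simp only [mem_preimage, mem_empty_iff_false, iff_false]
        exact fun h => hu h.1
      rw [this, measure_empty, ENNReal.toReal_zero]
      by_cases h1 : u ∈ S
      · rw [indicator_of_mem h1, indicator_of_notMem (s := A) fun h2 => hu ⟨h1, h2⟩]
      · rw [indicator_of_notMem h1]
  have mp := measurePreserving_comp_sum_embedding μ e
  rw [hpre, Measure.real, mp.measure_preimage hE.nullMeasurableSet, Measure.prod_apply hE,
    ← integral_toReal (measurable_measure_prodMk_left hE).aemeasurable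
      (.of_forall fun _ => measure_lt_top _ _)]
  simp only [hsec]
  rw [integral_indicator hS, irreducibleLaw, ← integral_indicator hA,
    integral_map hV.aemeasurable]
  exact ((by fun_prop : Measurable fun v : ℝ => (1 - v) ^ (T.card - I.card)).indicator
    hA).aestronglyMeasurable

/-- Almost surely exactly one subfamily of a sample of size `M` is irreducible and has the optimal
cost of the whole sample. -/
theorem sum_choose_mul_integral_irreducibleLaw (ha : Measurable P.a) (hb : Measurable P.b)
    (hnondeg : ∀ N : ℕ, 1 ≤ N →
      ∀ᵐ w ∂(Measure.pi fun _ : Fin N => μ), P.IsNondegenerate w)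
    {ζ : ℕ} (hζ : ∀ ω β : Finset Δ, P.IsEssential ω β → β.card ≤ ζ) {M : ℕ} (hM : 1 ≤ M) :
    ∑ k ∈ Finset.range (ζ + 1),
      (M.choose k : ℝ) * ∫ v, (1 - v) ^ (M - k) ∂P.irreducibleLaw μ k = 1 := by
  have h0 := P.sum_powerset_integral_irreducibleLaw μ hζ M univ
  simp only [setIntegral_univ] at h0
  rw [← h0]
  let D : Finset ℕ → Set (ℕ → Δ) := fun I => {ω | P.IsIrreducible ω I ∧
    P.costOn ω (Finset.range M) = P.costOn ω I}
  have hD (I) : MeasurableSet (D I) := (P.measurableSet_isIrreducible ha hb I).inter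
    (P.measurableSet_costOn_eq ha hb _ I)
  have h1 (I) (hI : I ∈ (Finset.range M).powerset) :
      ∫ v, (1 - v) ^ (M - I.card) ∂P.irreducibleLaw μ I.card =
      (Measure.infinitePi fun _ : ℕ => μ).real (D I) := by
    have := P.measureReal_isIrreducible_and_costOn_eq μ ha hb (Finset.mem_powerset.1 hI)
      MeasurableSet.univ
    simpa [D] using this.symm
  rw [Finset.sum_congr rfl h1]
  have hcover : ⋃ I ∈ (Finset.range M).powerset, D I = univ := by
    refine eq_univ_of_forall fun ω => ?_
    obtain ⟨I, hI, h2⟩ := P.exists_isIrreducible ω (Finset.range M)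
    exact mem_biUnion (Finset.mem_coe.2 (Finset.mem_powerset.2 hI)) h2
  have hdisj : Set.Pairwise ((Finset.range M).powerset : Set (Finset ℕ))
      (Function.onFun (AEDisjoint (Measure.infinitePi fun _ : ℕ => μ)) D) := by
    intro I hI J hJ hne
    rw [Function.onFun, AEDisjoint, ← compl_compl (D I ∩ D J), ← mem_ae_iff]
    filter_upwards [P.ae_eq_of_isIrreducible μ ha hb hnondeg
      (T := Finset.range M) (Finset.nonempty_range_iff.2 (by omega))] with ω hω h
    exact hne (hω I (Finset.mem_powerset.1 hI) J (Finset.mem_powerset.1 hJ)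
      h.1.1 h.1.2 h.2.1 h.2.2)
  have h3 := measure_biUnion_finset₀ hdisj fun I _ => (hD I).nullMeasurableSet
  rw [hcover, measure_univ] at h3
  simp only [Measure.real]
  rw [← ENNReal.toReal_sum fun _ _ => measure_ne_top _ _, ← h3, ENNReal.toReal_one]

/-- The irreducible subfamily with the optimal cost of the whole sample has the same violating
probability as the whole sample. -/
theorem measureReal_lt_violation_le (ha : Measurable P.a) (hb : Measurable P.b)
    {ζ : ℕ} (hζ : ∀ ω β : Finset Δ, P.IsEssential ω β → β.card ≤ ζ) (N : ℕ) (ε : ℝ) :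
    (Measure.pi fun _ : Fin N => μ).real {w | ε < P.violation μ w} ≤
    ∑ k ∈ Finset.range (ζ + 1),
      (N.choose k : ℝ) * ∫ v in Ioi ε, (1 - v) ^ (N - k) ∂P.irreducibleLaw μ k := by
  classical
  rw [← P.sum_powerset_integral_irreducibleLaw μ hζ]
  let e : Fin N ↪ ℕ := Fin.valEmbedding
  have he : Finset.univ.map e = Finset.range N := by
    ext i; simp [e]
  have hviol (w : Fin N → Δ) : P.violation μ w = μ.real (P.violatedOn w Finset.univ) := by
    simp only [violation, violatedOn, violatedSet, sampleSet]
  have hm : MeasurableSet {w : Fin N → Δ | ε < P.violation μ w} := by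
    simp only [hviol]
    exact measurableSet_lt measurable_const (P.measurable_measureReal_violatedOn μ ha hb _)
  rw [Measure.real, ← (measurePreserving_comp_embedding μ e).measure_preimage
    hm.nullMeasurableSet, ← Measure.real]
  let D : Finset ℕ → Set (ℕ → Δ) := fun I => {ω | P.IsIrreducible ω I ∧
    P.costOn ω (Finset.range N) = P.costOn ω I ∧ μ.real (P.violatedOn ω I) ∈ Ioi ε}
  have hsub : (fun ω : ℕ → Δ => ω ∘ e) ⁻¹' {w | ε < P.violation μ w} ⊆
      ⋃ I ∈ (Finset.range N).powerset, D I := by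
    intro ω hω
    obtain ⟨I, hI, hirr, hc⟩ := P.exists_isIrreducible ω (Finset.range N)
    refine mem_biUnion (Finset.mem_coe.2 (Finset.mem_powerset.2 hI)) ⟨hirr, hc, ?_⟩
    rw [mem_preimage, mem_ofPred_eq, hviol, violatedOn_comp, he,
      P.violatedOn_eq_of_costOn_eq ω hI hc] at hω
    exact hω
  refine (measureReal_mono hsub (measure_ne_top _ _)).trans
    ((measureReal_biUnion_finset_le _ _).trans_eq ?_)
  refine Finset.sum_congr rfl fun I hI => ?_
  have := P.measureReal_isIrreducible_and_costOn_eq μ ha hb (Finset.mem_powerset.1 hI)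
    (measurableSet_Ioi (a := ε))
  rwa [Finset.card_range] at this

/-- Linear combinations of the identities for the individual sample sizes, with the coefficients
of a polynomial `q` without constant term as weights. -/
theorem sum_integral_hasseDeriv_eval (ha : Measurable P.a) (hb : Measurable P.b)
    (hnondeg : ∀ N : ℕ, 1 ≤ N →
      ∀ᵐ w ∂(Measure.pi fun _ : Fin N => μ), P.IsNondegenerate w)
    {ζ : ℕ} (hζ : ∀ ω β : Finset Δ, P.IsEssential ω β → β.card ≤ ζ)
    {q : Polynomial ℝ} (hq : q.coeff 0 = 0) :
    ∑ k ∈ Finset.range (ζ + 1),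
      ∫ v, (Polynomial.hasseDeriv k q).eval (1 - v) ∂P.irreducibleLaw μ k = q.eval 1 := by
  have h (k) (v : ℝ) : (Polynomial.hasseDeriv k q).eval (1 - v) =
      ∑ M ∈ q.support, q.coeff M * ((M.choose k : ℝ) * (1 - v) ^ (M - k)) := by
    rw [Polynomial.hasseDeriv_apply, Polynomial.sum_def, Polynomial.eval_finsetSum]
    refine Finset.sum_congr rfl fun M _ => ?_
    rw [Polynomial.eval_monomial]; ring
  simp only [h]
  have h2 (k) : ∫ v, ∑ M ∈ q.support, q.coeff M * ((M.choose k : ℝ) * (1 - v) ^ (M - k))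
      ∂P.irreducibleLaw μ k = ∑ M ∈ q.support, q.coeff M *
        ((M.choose k : ℝ) * ∫ v, (1 - v) ^ (M - k) ∂P.irreducibleLaw μ k) := by
    rw [integral_finsetSum _ fun M _ => P.integrable_irreducibleLaw μ ha hb k (by fun_prop)]
    simp only [integral_const_mul]
  simp only [h2]
  rw [Finset.sum_comm, Polynomial.eval_eq_sum, Polynomial.sum_def]
  refine Finset.sum_congr rfl fun M hM => ?_
  have hM0 : 1 ≤ M := Nat.one_le_iff_ne_zero.2 fun h0 => Polynomial.mem_support_iff.1 hM (h0 ▸ hq)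
  rw [← Finset.mul_sum, P.sum_choose_mul_integral_irreducibleLaw μ ha hb hnondeg hζ hM0, one_pow]

end QuasiLinearProblem

end

noncomputable section

/-! ### Polynomial majorants -/

namespace Polynomial

/-- The antiderivative of a real polynomial that vanishes at `0`. -/
def antideriv (p : ℝ[X]) : ℝ[X] := p.sum fun i r => monomial (i + 1) (r / (i + 1))

theorem coeff_antideriv_succ (p : ℝ[X]) (n : ℕ) :
    (antideriv p).coeff (n + 1) = p.coeff n / (n + 1) := by
  rw [antideriv, sum_def, finsetSum_coeff]
  simp only [coeff_monomial, add_left_inj, Finset.sum_ite_eq', mem_support_iff]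
  split_ifs with h
  · rfl
  · rw [not_not.1 h, zero_div]

theorem coeff_antideriv_zero (p : ℝ[X]) : (antideriv p).coeff 0 = 0 := by
  rw [antideriv, sum_def, finsetSum_coeff]
  simp [coeff_monomial]

theorem eval_zero_antideriv (p : ℝ[X]) : (antideriv p).eval 0 = 0 := by
  rw [← coeff_zero_eq_eval_zero, coeff_antideriv_zero]

theorem derivative_antideriv (p : ℝ[X]) : derivative (antideriv p) = p := by
  ext n
  rw [coeff_derivative, coeff_antideriv_succ, div_mul_cancel₀]
  positivity

theorem antideriv_derivative {p : ℝ[X]} (h : p.coeff 0 = 0) : antideriv (derivative p) = p := by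
  ext (_ | n)
  · rw [coeff_antideriv_zero, h]
  · rw [coeff_antideriv_succ, coeff_derivative, mul_div_cancel_right₀]
    positivity

theorem hasDerivAt_antideriv (p : ℝ[X]) (t : ℝ) :
    HasDerivAt (fun t => (antideriv p).eval t) (p.eval t) t := by
  simpa only [derivative_antideriv] using (antideriv p).hasDerivAt t

theorem antideriv_eval_le {p q : ℝ[X]} {s : ℝ}
    (h : ∀ t ∈ Ico 0 s, p.eval t ≤ q.eval t) :
    ∀ t ∈ Ico 0 s, (antideriv p).eval t ≤ (antideriv q).eval t := by
  intro t ht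
  have hmono : MonotoneOn (fun t => (antideriv q).eval t - (antideriv p).eval t) (Ico 0 s) := by
    refine monotoneOn_of_hasDerivWithinAt_nonneg (f' := fun t => q.eval t - p.eval t)
      (convex_Ico 0 s) (by fun_prop)
      (fun x _ => ((hasDerivAt_antideriv q x).sub (hasDerivAt_antideriv p x)).hasDerivWithinAt)
      fun x hx => ?_
    exact sub_nonneg.2 (h x (interior_subset hx))
  have := hmono ⟨le_rfl, ht.1.trans_lt ht.2⟩ ht ht.1
  simp only [eval_zero_antideriv, sub_zero] at this
  linarith

theorem iterate_antideriv_eval_le {p q : ℝ[X]} {s : ℝ}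
    (h : ∀ t ∈ Ico 0 s, p.eval t ≤ q.eval t) (n : ℕ) :
    ∀ t ∈ Ico 0 s, (antideriv^[n] p).eval t ≤ (antideriv^[n] q).eval t := by
  induction n with
  | zero => exact h
  | succ n ih =>
    rw [Function.iterate_succ_apply', Function.iterate_succ_apply']
    exact antideriv_eval_le ih

theorem iterate_antideriv_zero (n : ℕ) : antideriv^[n] 0 = 0 := by
  induction n with
  | zero => rfl
  | succ n ih => rw [Function.iterate_succ_apply', ih]; simp [antideriv]

theorem derivative_iterate_antideriv (p : ℝ[X]) {k n : ℕ} (h : k ≤ n) :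
    derivative^[k] (antideriv^[n] p) = antideriv^[n - k] p := by
  induction k with
  | zero => rfl
  | succ k ih =>
    rw [Function.iterate_succ_apply', ih (by omega), show n - k = n - (k + 1) + 1 by omega,
      Function.iterate_succ_apply', derivative_antideriv]

theorem antideriv_iterate_derivative_X_pow {k n N : ℕ} (hk : k ≤ n) (hn : n ≤ N) :
    antideriv^[n - k] (derivative^[n] (X ^ N)) = derivative^[k] (X ^ N : ℝ[X]) := by
  induction hk using Nat.decreasingInduction with
  | self => simp
  | of_succ k hk ih =>
    rw [show n - k = n - (k + 1) + 1 by omega, Function.iterate_succ_apply', ih,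
      Function.iterate_succ_apply', antideriv_derivative]
    rw [coeff_iterate_derivative, coeff_X_pow, if_neg (by omega), smul_zero]

/-- Cauchy's formula for repeated integration. -/
theorem iterate_antideriv_eval_one (p : ℝ[X]) (n : ℕ) :
    (antideriv^[n + 1] p).eval 1 =
      ∫ t in (0 : ℝ)..1, (1 - t) ^ n / (n.factorial : ℝ) * p.eval t := by
  induction n generalizing p with
  | zero =>
    rw [intervalIntegral.integral_eq_sub_of_hasDerivAt (f := fun t => (antideriv p).eval t)
      (fun t _ => by simpa using hasDerivAt_antideriv p t)
      (Continuous.intervalIntegrable (by fun_prop) _ _)]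
    simp [eval_zero_antideriv]
  | succ n ih =>
    rw [Function.iterate_succ_apply, ih]
    have hu (t : ℝ) : HasDerivAt (fun t : ℝ => (1 - t) ^ (n + 1) / ((n + 1).factorial : ℝ))
        (-((1 - t) ^ n / (n.factorial : ℝ))) t := by
      have := ((((hasDerivAt_id t).const_sub 1).pow (n + 1)).div_const ((n + 1).factorial : ℝ))
      refine this.congr_deriv ?_
      rw [Nat.factorial_succ]
      have : (n.factorial : ℝ) ≠ 0 := by positivity
      push_cast
      simp only [id]
      field_simp
    rw [intervalIntegral.integral_mul_deriv_eq_deriv_mul (fun t _ => hu t)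
      (fun t _ => hasDerivAt_antideriv p t) (Continuous.intervalIntegrable (by fun_prop) _ _)
      (Continuous.intervalIntegrable (by fun_prop) _ _)]
    simp [eval_zero_antideriv]

end Polynomial

open Polynomial in
/-- On `[0, 1]`, the truncation of a nonnegative polynomial `f` to `[0, h)` is dominated by a
polynomial whose integral against the weight `W` is larger by at most `η`. -/
theorem exists_polynomial_ge_truncation (f : ℝ[X]) (hf : ∀ t ∈ Icc (0 : ℝ) 1, 0 ≤ f.eval t)
    {h : ℝ} (hh : h ∈ Ioo (0 : ℝ) 1) {W : ℝ → ℝ} (hW : Continuous W)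
    (hW0 : ∀ t ∈ Icc (0 : ℝ) 1, 0 ≤ W t) {η : ℝ} (hη : 0 < η) :
    ∃ p : ℝ[X], (∀ t ∈ Icc (0 : ℝ) 1, 0 ≤ p.eval t) ∧
      (∀ t ∈ Ico 0 h, f.eval t ≤ p.eval t) ∧
      ∫ t in (0 : ℝ)..1, W t * p.eval t ≤ (∫ t in (0 : ℝ)..h, W t * f.eval t) + η := by
  obtain ⟨A, hA⟩ := isCompact_Icc.bddAbove_image (f := fun t => W t * f.eval t)
    (K := Icc (0 : ℝ) 1) (by fun_prop)
  obtain ⟨B, hB⟩ := isCompact_Icc.bddAbove_image (f := W) (K := Icc (0 : ℝ) 1) (by fun_prop)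
  have hAf : ∀ t ∈ Icc (0 : ℝ) 1, W t * f.eval t ≤ max A 0 := fun t ht =>
    (hA (mem_image_of_mem _ ht)).trans (le_max_left _ _)
  have hBW : ∀ t ∈ Icc (0 : ℝ) 1, W t ≤ max B 0 := fun t ht =>
    (hB (mem_image_of_mem _ ht)).trans (le_max_left _ _)
  set A' := max A 0
  set B' := max B 0
  have hA0 : 0 ≤ A' := le_max_right _ _
  have hB0 : 0 ≤ B' := le_max_right _ _
  -- The cut-off `χ` decreases from `1` to `0` on `[h, h + δ]`.
  obtain ⟨δ, hδ, hδ1, hδA⟩ : ∃ δ > 0, h + δ ≤ 1 ∧ A' * δ ≤ η / 2 := by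
    refine ⟨min (1 - h) (η / 2 / (A' + 1)), lt_min (by linarith [hh.2]) (by positivity), ?_, ?_⟩
    · linarith [min_le_left (1 - h) (η / 2 / (A' + 1))]
    · calc A' * min (1 - h) (η / 2 / (A' + 1)) ≤ (A' + 1) * (η / 2 / (A' + 1)) := by
            refine mul_le_mul (by linarith) (min_le_right _ _) (le_min ?_ (by positivity))
              (by linarith)
            linarith [hh.2]
        _ = η / 2 := by field_simp
  let χ : ℝ → ℝ := fun t => max 0 (min 1 (1 - (t - h) / δ))
  have hχ : Continuous χ := by fun_prop
  have hχ0 (t) : 0 ≤ χ t := le_max_left _ _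
  have hχ1 (t) : χ t ≤ 1 := max_le zero_le_one (min_le_left _ _)
  have hχl (t) (ht : t ≤ h) : χ t = 1 := by
    have : (t - h) / δ ≤ 0 := div_nonpos_of_nonpos_of_nonneg (by linarith) hδ.le
    simp only [χ]
    rw [min_eq_left (by linarith), max_eq_right zero_le_one]
  have hχr (t) (ht : h + δ ≤ t) : χ t = 0 := by
    have : 1 ≤ (t - h) / δ := (one_le_div hδ).2 (by linarith)
    simp only [χ]
    rw [max_eq_left]
    exact (min_le_right _ _).trans (by linarith)
  let σ : ℝ := η / (4 * (B' + 1))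
  have hσ : 0 < σ := by positivity
  obtain ⟨p, hp⟩ := exists_polynomial_near_of_continuousOn 0 1 (fun t => f.eval t * χ t)
    (by fun_prop) σ hσ
  -- Adding the error `σ` makes the uniform approximation one-sided.
  refine ⟨p + C σ, fun t ht => ?_, fun t ht => ?_, ?_⟩
  · have := (abs_lt.1 (hp t ht)).1
    have h2 := mul_nonneg (hf t ht) (hχ0 t)
    simp only [eval_add, eval_C]
    linarith
  · have := (abs_lt.1 (hp t ⟨ht.1, by linarith [ht.2, hh.2]⟩)).1
    simp only [hχl t ht.2.le, mul_one] at this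
    simp only [eval_add, eval_C]
    linarith
  · have e1 : ∫ t in (0 : ℝ)..1, W t * (p + C σ).eval t ≤
        ∫ t in (0 : ℝ)..1, (W t * f.eval t * χ t + η / 2) := by
      refine intervalIntegral.integral_mono_on zero_le_one
        (Continuous.intervalIntegrable (by fun_prop) _ _)
        (Continuous.intervalIntegrable (by fun_prop) _ _) fun t ht => ?_
      have h1 := (abs_lt.1 (hp t ht)).2
      have h2 : W t * (p + C σ).eval t ≤ W t * (f.eval t * χ t + 2 * σ) := by
        refine mul_le_mul_of_nonneg_left ?_ (hW0 t ht)
        simp only [eval_add, eval_C]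
        linarith
      have h3 : W t * (2 * σ) ≤ (B' + 1) * (2 * σ) :=
        mul_le_mul_of_nonneg_right (by linarith [hBW t ht]) (by positivity)
      have h4 : (B' + 1) * (2 * σ) = η / 2 := by simp only [σ]; field_simp; ring
      linarith
    have hint (a b : ℝ) : IntervalIntegrable (fun t => W t * f.eval t * χ t) volume a b :=
      Continuous.intervalIntegrable (by fun_prop) _ _
    have e2 : ∫ t in (0 : ℝ)..1, (W t * f.eval t * χ t + η / 2) =
        (∫ t in (0 : ℝ)..h, W t * f.eval t * χ t) + (∫ t in h..(h + δ), W t * f.eval t * χ t) +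
        (∫ t in (h + δ)..1, W t * f.eval t * χ t) + η / 2 := by
      rw [intervalIntegral.integral_add (hint _ _) (by simp),
        intervalIntegral.integral_add_adjacent_intervals (hint _ _) (hint _ _),
        intervalIntegral.integral_add_adjacent_intervals (hint _ _) (hint _ _)]
      simp
    have e3 : ∫ t in (0 : ℝ)..h, W t * f.eval t * χ t = ∫ t in (0 : ℝ)..h, W t * f.eval t := by
      refine intervalIntegral.integral_congr fun t ht => ?_
      rw [uIcc_of_le hh.1.le] at ht
      simp only [hχl t ht.2, mul_one]
    have e4 : ∫ t in (h + δ)..1, W t * f.eval t * χ t = 0 := by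
      rw [intervalIntegral.integral_congr (g := fun _ => (0 : ℝ))]
      · simp
      · intro t ht
        rw [uIcc_of_le hδ1] at ht
        simp only [hχr t ht.1, mul_zero]
    have e5 : ∫ t in h..(h + δ), W t * f.eval t * χ t ≤ η / 2 := by
      calc ∫ t in h..(h + δ), W t * f.eval t * χ t ≤ ∫ t in h..(h + δ), A' := by
            refine intervalIntegral.integral_mono_on (by linarith) (hint _ _) (by simp)
              fun t ht => ?_
            have htI : t ∈ Icc (0 : ℝ) 1 := ⟨hh.1.le.trans ht.1, ht.2.trans hδ1⟩
            exact (mul_le_of_le_one_right (mul_nonneg (hW0 t htI) (hf t htI)) (hχ1 t)).trans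
              (hAf t htI)
        _ = A' * δ := by simp [mul_comm]
        _ ≤ η / 2 := hδA
    linarith

theorem scenarioBeta_eq_integral (ε : ℝ) {ζ N : ℕ} (hζ : 1 ≤ ζ) (hN : ζ ≤ N) :
    scenarioBeta ε (ζ - 1) N = ∫ t in (0 : ℝ)..(1 - ε),
      (1 - t) ^ (ζ - 1) / ((ζ - 1).factorial : ℝ) * ((N.descFactorial ζ : ℝ) * t ^ (N - ζ)) := by
  obtain ⟨k, rfl⟩ : ∃ k, ζ = k + 1 := ⟨ζ - 1, by omega⟩
  obtain ⟨n, rfl⟩ : ∃ n, N = n + (k + 1) := ⟨N - (k + 1), by omega⟩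
  have h1 : ((n + (k + 1) : ℕ) : ℝ) - (k : ℕ) = n + 1 := by push_cast; ring
  have hbeta : ProbabilityTheory.beta ((n : ℝ) + 1) ((k : ℝ) + 1) =
      (n.factorial * k.factorial : ℝ) / ((n + (k + 1)).factorial : ℝ) := by
    have h2 : (n : ℝ) + 1 + ((k : ℝ) + 1) = ((n + (k + 1) : ℕ) : ℝ) + 1 := by push_cast; ring
    rw [ProbabilityTheory.beta, h2, Real.Gamma_nat_eq_factorial, Real.Gamma_nat_eq_factorial,
      Real.Gamma_nat_eq_factorial]
  have hdesc : ((n + (k + 1)).descFactorial (k + 1) : ℝ) =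
      ((n + (k + 1)).factorial : ℝ) / (n.factorial : ℝ) := by
    rw [eq_div_iff (by positivity), mul_comm]
    exact_mod_cast (Nat.add_sub_cancel n (k + 1)) ▸
      Nat.factorial_mul_descFactorial (Nat.le_add_left (k + 1) n)
  simp only [scenarioBeta, regIncompleteBeta, Nat.add_sub_cancel, h1, hbeta, hdesc,
    add_sub_cancel_right, Real.rpow_natCast]
  rw [div_eq_mul_inv, ← intervalIntegral.integral_mul_const]
  refine intervalIntegral.integral_congr fun t _ => ?_
  have : (n.factorial : ℝ) ≠ 0 := by positivity
  have : (k.factorial : ℝ) ≠ 0 := by positivity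
  have : ((n + (k + 1)).factorial : ℝ) ≠ 0 := by positivity
  field_simp

open Polynomial in
/-- A polynomial approximating, from above and together with its derivatives of order at most `ζ`,
the function that equals `t ^ N` up to `1 - ε` and continues from there as its Taylor polynomial of
degree `ζ - 1`. The value of the latter at `1` is `scenarioBeta ε (ζ - 1) N`. -/
theorem exists_polynomial_hasseDeriv_ge {ζ N : ℕ} (hζ : 1 ≤ ζ) (hN : ζ ≤ N) {ε : ℝ}
    (hε : ε ∈ Ioo (0 : ℝ) 1) {η : ℝ} (hη : 0 < η) :
    ∃ q : ℝ[X], q.coeff 0 = 0 ∧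
      (∀ k ≤ ζ, ∀ t ∈ Icc (0 : ℝ) 1, 0 ≤ (hasseDeriv k q).eval t) ∧
      (∀ k ≤ ζ, ∀ t ∈ Ico (0 : ℝ) (1 - ε),
        (N.choose k : ℝ) * t ^ (N - k) ≤ (hasseDeriv k q).eval t) ∧
      q.eval 1 ≤ scenarioBeta ε (ζ - 1) N + η := by
  set f : ℝ[X] := derivative^[ζ] (X ^ N) with hf
  have hfe (t : ℝ) : f.eval t = (N.descFactorial ζ : ℝ) * t ^ (N - ζ) := by
    rw [hf, iterate_derivative_X_pow_eq_natCast_mul]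
    simp
  obtain ⟨p, hp0, hpf, hpi⟩ := exists_polynomial_ge_truncation f
    (fun t ht => by rw [hfe]; exact mul_nonneg (by positivity) (pow_nonneg ht.1 _))
    (h := 1 - ε) ⟨by linarith [hε.2], by linarith [hε.1]⟩
    (W := fun t => (1 - t) ^ (ζ - 1) / ((ζ - 1).factorial : ℝ)) (by fun_prop)
    (fun t ht => div_nonneg (pow_nonneg (by linarith [ht.2]) _) (by positivity)) hη
  have hhasse (k : ℕ) (q : ℝ[X]) (t : ℝ) :
      (k.factorial : ℝ) * (hasseDeriv k q).eval t = (derivative^[k] q).eval t := by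
    rw [← factorial_smul_hasseDeriv]
    simp
  refine ⟨antideriv^[ζ] p, ?_, fun k hk t ht => ?_, fun k hk t ht => ?_, ?_⟩
  · obtain ⟨n, rfl⟩ : ∃ n, ζ = n + 1 := ⟨ζ - 1, by omega⟩
    rw [Function.iterate_succ_apply', coeff_antideriv_zero]
  · have hclosed : ∀ t ∈ Ico (0 : ℝ) 1, 0 ≤ (antideriv^[ζ - k] p).eval t := by
      have := iterate_antideriv_eval_le (p := 0) (q := p) (s := 1)
        (fun t ht => by simpa using hp0 t ⟨ht.1, ht.2.le⟩) (ζ - k)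
      simpa [iterate_antideriv_zero] using this
    have h1 : 0 ≤ (antideriv^[ζ - k] p).eval t := by
      have hcl : IsClosed {t : ℝ | 0 ≤ (antideriv^[ζ - k] p).eval t} :=
        isClosed_le continuous_const (by fun_prop)
      rw [← closure_Ico (zero_ne_one' ℝ)] at ht
      exact closure_minimal hclosed hcl ht
    rw [← derivative_iterate_antideriv p hk, ← hhasse] at h1
    exact nonneg_of_mul_nonneg_right h1 (by positivity)
  · have h1 := iterate_antideriv_eval_le hpf (ζ - k) t ht
    rw [hf, antideriv_iterate_derivative_X_pow hk hN, ← derivative_iterate_antideriv p hk,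
      ← hhasse, ← hhasse] at h1
    have h2 := le_of_mul_le_mul_left h1 (by positivity)
    rwa [← monomial_one_right_eq_X_pow, hasseDeriv_monomial, eval_monomial, mul_one] at h2
  · have := iterate_antideriv_eval_one p (ζ - 1)
    rw [Nat.sub_add_cancel hζ] at this
    rw [this, scenarioBeta_eq_integral ε hζ hN]
    simpa only [hfe] using hpi

end

/-! ### The bound on the violating probability -/

theorem mainTheorem1 {d : ℕ} {Δ : Type*} [MeasurableSpace Δ]
    (P : QuasiLinearProblem d Δ) (ha : Measurable P.a) (hb : Measurable P.b)
    (μ : Measure Δ) [IsProbabilityMeasure μ]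
    (hnondeg : ∀ N : ℕ, 1 ≤ N →
      ∀ᵐ w ∂(Measure.pi fun _ : Fin N => μ), P.IsNondegenerate w)
    (ζ : ℕ) (hζ_pos : 1 ≤ ζ)
    (hζ : ∀ ω β : Finset Δ, P.IsEssential ω β → β.card ≤ ζ)
    (N : ℕ) (hN : ζ ≤ N) (ε : ℝ) (hε : ε ∈ Set.Ioo (0 : ℝ) 1) :
    (Measure.pi fun _ : Fin N => μ).real {w | ε < P.violation μ w}
      ≤ scenarioBeta ε (ζ - 1) N := by
  refine le_of_forall_pos_le_add fun η hη => ?_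
  obtain ⟨q, hq0, hqnonneg, hqge, hq1⟩ := exists_polynomial_hasseDeriv_ge hζ_pos hN hε hη
  refine (P.measureReal_lt_violation_le μ ha hb hζ N ε).trans (le_trans ?_ hq1)
  rw [← P.sum_integral_hasseDeriv_eval μ ha hb hnondeg hζ hq0]
  refine Finset.sum_le_sum fun k hk => ?_
  have hkζ : k ≤ ζ := Nat.lt_succ_iff.1 (Finset.mem_range.1 hk)
  rw [← integral_const_mul, ← integral_indicator measurableSet_Ioi]
  refine integral_mono_ae
    ((P.integrable_irreducibleLaw μ ha hb k (by fun_prop)).indicator measurableSet_Ioi)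
    (P.integrable_irreducibleLaw μ ha hb k (by fun_prop)) ?_
  filter_upwards [P.ae_mem_Icc_irreducibleLaw μ ha hb k] with v hv
  by_cases hvε : v ∈ Ioi ε
  · rw [indicator_of_mem hvε]
    exact hqge k hkζ (1 - v) ⟨by linarith [hv.2], by linarith [mem_Ioi.1 hvε]⟩
  · rw [indicator_of_notMem hvε]
    exact hqnonneg k hkζ (1 - v) ⟨by linarith [hv.2], by linarith [hv.1]⟩
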